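/- Let $\psi=\Gamma'/\Gamma$, and let $1/\Gamma$ denote the entire reciprocal Gamma function (so $1/\Gamma(z)=0$ for $z=0,-1,-2,\dots$). Let $c,m,f\in\mathbb C$ with $c\notin\mathbb Z$, $f\notin\mathbb Z$, $\Re(m-c)>1$, and suppose that $m\in\mathbb Z$ or $\Re(m-f)>-1$. For integers $l\ge 0$ put $$t_l=\frac{\Gamma(f-c+l)\,(-1)^l}{\Gamma(2-c+l)\,\Gamma(l+1)\,\Gamma(m-1-l)\,(1-c+l)} .$$ (a) If $c-f\notin\{0,1,2,\dots\}$, then $\sum_{l\ge0}t_l$ converges absolutely, and so does the series on the left below, and $$\sum_{l=0}^{\infty}\frac{\Gamma(c+l)}{\Gamma(m+l)}\,\psi(f+l)=\frac{\Gamma(c)}{m-c-1}\left\{\frac{\psi(f-1)+\frac1{m-c-1}}{\Gamma(m-1)}-\frac{\Gamma(f)\Gamma(1-f)\Gamma(1-c)}{\Gamma(f-c)\Gamma(m-f)}-\frac{\Gamma(2-f)\Gamma(m-c)}{\Gamma(m-f)\Gamma(f-c)}\sum_{l=0}^{\infty}t_l\right\}.$$ If moreover $m$ is an integer, then $t_l=0$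 for every $l\ge m-1$, so the series $\sum_l t_l$ terminates. (b) If $c=f+k$ for an integer $k\ge0$, the left-hand series still converges absolutely and the same formula holds with $1/\Gamma(f-c)=0$ in the second term and $\Gamma(f-c+l)/\Gamma(f-c)$ in the third term read as the rising factorial $(f-c)_l$, that is, $$\sum_{l=0}^{\infty}\frac{\Gamma(c+l)}{\Gamma(m+l)}\,\psi(f+l)=\frac{\Gamma(c)}{m-c-1}\left\{\frac{\psi(f-1)+\frac1{m-c-1}}{\Gamma(m-1)}-\frac{\Gamma(2-f)\Gamma(m-c)}{\Gamma(m-f)}\sum_{l=0}^{k}\frac{(f-c)_l\,(-1)^l}{\Gamma(2-c+l)\,\Gamma(l+1)\,\Gamma(m-1-l)\,(1-c+l)}\right\}.$$ -/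

import Mathlib

/-- The general term
`Γ(f-c+l) (-1)^l / (Γ(2-c+l) Γ(l+1) Γ(m-1-l) (1-c+l))` of the auxiliary series.
Mathlib has `Γ = 0` at the poles of `Γ` and `x / 0 = 0`, so that a factor `1 / Γ(m-1-l)` is the
value of the entire function `1 / Γ` for every `m`, including integers. -/
noncomputable def auxTerm (c m f : ℂ) (l : ℕ) : ℂ :=
  Complex.Gamma (f - c + l) * (-1) ^ l /
    (Complex.Gamma (2 - c + l) * Complex.Gamma (l + 1) * Complex.Gamma (m - 1 - l) * (1 - c + l))

/-- The general term of the auxiliary series divided by `Γ(f-c)`, where `Γ(f-c+l) / Γ(f-c)` is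
read as the rising factorial `(f-c)_l`. -/
noncomputable def auxTermRatio (c m f : ℂ) (l : ℕ) : ℂ :=
  (ascPochhammer ℂ l).eval (f - c) * (-1) ^ l /
    (Complex.Gamma (2 - c + l) * Complex.Gamma (l + 1) * Complex.Gamma (m - 1 - l) * (1 - c + l))


/-!
Put `p = m - 1` and `g = f - 1`. Since `ψ(g + 1 + l) = ψ(g + l) + 1 / (g + l)`, summation by parts
turns the digamma series into `pochSum c p g = ∑ (c)_l / (Γ(p + l) (g + l))`, and the theorem
becomes an evaluation of `pochSum` in closed form.

The series and its closed form satisfy the same first-order recurrences under `p ↦ p + 1`,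
`g ↦ g + 1` and `c ↦ c + 1`; for the closed form these come down to Gauss's evaluation of
`₂F₁(g + 1 - c, 1 - p; 2 - c; 1)`. Hence it suffices to show that the difference `defect c p g` of
the two vanishes if `Re c < Re g`, `0 < Re g < 2` and `Re p` is large. There the coefficients of the
auxiliary series have a partial fraction expansion, whose summation against `(-1)^l / (l! Γ(p - l))`
shows that the closed form, like `pochSum`, is made of inverse factorial series in `p`. By the
recurrence in `p`, `Γ(p - g) defect c p g` is invariant under `p ↦ p + 1`, while inverse factorial
series make it tend to `0` along `p + ℕ`.
-/

open Filter Topology Asymptotics Complex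
open scoped Nat

namespace GammaSum

/-- The entire function `1 / Γ`, with value `0` at the poles of `Γ`. -/
noncomputable def rGamma (z : ℂ) : ℂ := (Gamma z)⁻¹

/-- The rising factorial `(x)_l`. -/
noncomputable def poch (x : ℂ) (l : ℕ) : ℂ := (ascPochhammer ℂ l).eval x

/-! ### The reciprocal Gamma function and rising factorials -/

lemma rGamma_eq_mul (z : ℂ) : rGamma z = z * rGamma (z + 1) :=
  one_div_Gamma_eq_self_mul_one_div_Gamma_add_one z

lemma rGamma_neg_nat (n : ℕ) : rGamma (-n) = 0 := by
  rw [rGamma, Gamma_neg_nat_eq_zero, inv_zero]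

lemma rGamma_one : rGamma 1 = 1 := by rw [rGamma, Gamma_one, inv_one]

lemma rGamma_ne_zero {z : ℂ} (hz : ∀ n : ℕ, z ≠ -n) : rGamma z ≠ 0 :=
  inv_ne_zero (Gamma_ne_zero hz)

lemma Gamma_mul_rGamma {z : ℂ} (hz : ∀ n : ℕ, z ≠ -n) : Gamma z * rGamma z = 1 :=
  mul_inv_cancel₀ (Gamma_ne_zero hz)

lemma Gamma_mul_rGamma_of_re_pos {z : ℂ} (hz : 0 < z.re) : Gamma z * rGamma z = 1 :=
  mul_inv_cancel₀ (Gamma_ne_zero_of_re_pos hz)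

@[simp]
lemma poch_zero (x : ℂ) : poch x 0 = 1 := by simp [poch]

lemma poch_succ (x : ℂ) (l : ℕ) : poch x (l + 1) = poch x l * (x + l) :=
  ascPochhammer_succ_eval l x

lemma poch_succ_left (x : ℂ) (l : ℕ) : poch x (l + 1) = x * poch (x + 1) l := by
  simp [poch, ascPochhammer_succ_left]

lemma prod_range_add_eq_poch (x : ℂ) (n : ℕ) : ∏ j ∈ Finset.range n, (x + j) = poch x n := by
  induction n with
  | zero => simp
  | succ n ih => rw [Finset.prod_range_succ, ih, poch_succ]

lemma rGamma_eq_poch_mul (x : ℂ) (n : ℕ) : rGamma x = poch x n * rGamma (x + n) := by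
  induction n with
  | zero => simp
  | succ n ih =>
    rw [ih, poch_succ, rGamma_eq_mul (x + n), Nat.cast_succ, add_assoc x, mul_assoc]

section NonPole

variable {x : ℂ} (hx : ∀ n : ℕ, x ≠ -n)

include hx

lemma Gamma_add_nat (n : ℕ) : Gamma (x + n) = poch x n * Gamma x := by
  rw [poch, ← Gamma_add_nat_div_Gamma_eq x hx, div_mul_cancel₀ _ (Gamma_ne_zero hx)]

lemma poch_eq_Gamma_mul_rGamma (n : ℕ) : poch x n = Gamma (x + n) * rGamma x :=
  (Gamma_add_nat_div_Gamma_eq x hx).symm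

lemma poch_ne_zero (n : ℕ) : poch x n ≠ 0 := by
  have h := rGamma_ne_zero hx
  rw [rGamma_eq_poch_mul x n] at h
  exact left_ne_zero_of_mul h

lemma Gamma_mul_rGamma_add_nat (n : ℕ) : Gamma x * rGamma (x + n) = (poch x n)⁻¹ := by
  rw [← mul_eq_one_iff_eq_inv₀ (poch_ne_zero hx n), mul_assoc, mul_comm (rGamma _),
    ← rGamma_eq_poch_mul, Gamma_mul_rGamma hx]

lemma add_nat_ne_neg_nat (k n : ℕ) : x + k ≠ -n := by
  intro h
  apply hx (n + k)
  push_cast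
  linear_combination h

lemma add_nat_ne_zero (k : ℕ) : x + k ≠ 0 := by
  simpa using add_nat_ne_neg_nat hx k 0

end NonPole

lemma ne_zero_of_re_pos {z : ℂ} (hz : 0 < z.re) : z ≠ 0 :=
  ne_of_apply_ne re hz.ne'

lemma ne_neg_nat_of_re_pos {z : ℂ} (hz : 0 < z.re) (n : ℕ) : z ≠ -n := by
  refine ne_of_apply_ne re (ne_of_gt ?_)
  rw [neg_re, natCast_re]
  linarith [n.cast_nonneg (α := ℝ)]

lemma ne_neg_nat_of_mem_integerComplement {z : ℂ} (hz : z ∈ integerComplement) (n : ℕ) :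
    z ≠ -n :=
  fun h => hz ⟨-n, by rw [h]; push_cast; rfl⟩

lemma intCast_sub_mem_integerComplement {z : ℂ} (hz : z ∈ integerComplement) (k : ℤ) :
    k - z ∈ integerComplement := by
  rintro ⟨n, hn⟩
  exact hz ⟨k - n, by push_cast; linear_combination -hn⟩

lemma one_sub_mem_integerComplement {z : ℂ} (hz : z ∈ integerComplement) :
    1 - z ∈ integerComplement := by
  simpa using intCast_sub_mem_integerComplement hz 1

lemma add_one_mem_integerComplement {z : ℂ} :
    z + 1 ∈ integerComplement ↔ z ∈ integerComplement := by
  simpa using add_intCast_mem_integerComplement (x := z) 1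

/-! ### Asymptotics along the natural numbers -/

lemma eventually_re_add_nat_pos (y : ℂ) : ∀ᶠ n : ℕ in atTop, 0 < (y + n).re := by
  filter_upwards [eventually_gt_atTop ⌈-y.re⌉₊] with n hn
  have := Nat.lt_of_ceil_lt hn
  rw [add_re, natCast_re]
  linarith

lemma tendsto_add_nat_div (y : ℂ) :
    Tendsto (fun n : ℕ => (y + n) / (n : ℂ)) atTop (𝓝 1) := by
  have := (tendsto_natCast_div_add_atTop (𝕜 := ℂ) y).inv₀ one_ne_zero
  simpa [add_comm] using this

lemma tendsto_rGamma_add_one_add_nat {y : ℂ} (hy : ∀ n : ℕ, y ≠ -n) :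
    Tendsto (fun n : ℕ => rGamma (y + 1 + n) * n ! * (n : ℂ) ^ y) atTop (𝓝 1) := by
  have h := (GammaSeq_tendsto_Gamma y).mul_const (rGamma y)
  rw [Gamma_mul_rGamma hy] at h
  refine h.congr fun n => ?_
  rw [GammaSeq, prod_range_add_eq_poch, rGamma_eq_poch_mul y (n + 1), Nat.cast_succ,
    show y + (n + 1 : ℂ) = y + 1 + n by ring]
  field_simp [poch_ne_zero hy (n + 1)]

theorem tendsto_rGamma_add_nat (y : ℂ) :
    Tendsto (fun n : ℕ => rGamma (y + n) * n ! * (n : ℂ) ^ (y - 1)) atTop (𝓝 1) := by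
  obtain ⟨k, hk⟩ := exists_nat_gt (1 - y.re)
  induction k generalizing y with
  | zero =>
    have hy : 0 < (y - 1).re := by rw [sub_re, one_re]; push_cast at hk; linarith
    simpa using tendsto_rGamma_add_one_add_nat (ne_neg_nat_of_re_pos hy)
  | succ k ih =>
    have h := (ih (y + 1) (by rw [add_re, one_re]; push_cast at hk; linarith)).mul
      (tendsto_add_nat_div y)
    rw [one_mul] at h
    refine h.congr' ?_
    filter_upwards [eventually_ne_atTop 0] with n hn
    have hn' : (n : ℂ) ≠ 0 := Nat.cast_ne_zero.2 hn
    rw [rGamma_eq_mul (y + n), show y + 1 - 1 = (y - 1) + 1 by ring, cpow_add _ _ hn', cpow_one,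
      show y + 1 + n = y + n + 1 by ring]
    field_simp

lemma tendsto_Gamma_add_nat (y : ℂ) :
    Tendsto (fun n : ℕ => Gamma (y + n) / n ! * (n : ℂ) ^ (1 - y)) atTop (𝓝 1) := by
  have h := (tendsto_rGamma_add_nat y).inv₀ one_ne_zero
  rw [inv_one] at h
  refine h.congr fun n => ?_
  rw [← neg_sub y 1, cpow_neg, rGamma, mul_inv, mul_inv, inv_inv, div_eq_mul_inv]

lemma tendsto_poch (s : ℂ) :
    Tendsto (fun n : ℕ => poch s n / n ! * (n : ℂ) ^ (1 - s)) atTop (𝓝 (rGamma s)) := by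
  have h := (tendsto_Gamma_add_nat s).const_mul (rGamma s)
  rw [mul_one] at h
  refine h.congr' ?_
  filter_upwards [eventually_re_add_nat_pos s] with n hn
  rw [rGamma_eq_poch_mul s n]
  linear_combination (poch s n / n ! * (n : ℂ) ^ (1 - s)) * Gamma_mul_rGamma_of_re_pos hn

lemma isBigO_of_tendsto_mul_cpow {f : ℕ → ℂ} {w L : ℂ} {r : ℝ}
    (h : Tendsto (fun n : ℕ => f n * (n : ℂ) ^ w) atTop (𝓝 L)) (hr : r = -w.re) :
    f =O[atTop] fun n : ℕ => (n : ℝ) ^ r := by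
  have hO := (h.isBigO_one ℝ).norm_left.mul (isBigO_refl (fun n : ℕ => (n : ℝ) ^ r) atTop)
  simp only [one_mul] at hO
  refine IsBigO.trans (IsBigO.of_bound 1 ?_) hO
  filter_upwards [eventually_gt_atTop 0] with n hn
  have hn' : (0 : ℝ) < n := Nat.cast_pos.2 hn
  rw [norm_mul, norm_norm, norm_mul, norm_natCast_cpow_of_pos hn,
    Real.norm_of_nonneg (Real.rpow_nonneg hn'.le r), mul_assoc, ← Real.rpow_add hn', hr,
    add_neg_cancel, Real.rpow_zero, mul_one, one_mul]

lemma isBigO_mul_rpow {f g : ℕ → ℂ} {a b c : ℝ} (hf : f =O[atTop] fun n : ℕ => (n : ℝ) ^ a)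
    (hg : g =O[atTop] fun n : ℕ => (n : ℝ) ^ b) (hc : c = a + b) :
    (fun n => f n * g n) =O[atTop] fun n : ℕ => (n : ℝ) ^ c := by
  refine (hf.mul hg).congr' EventuallyEq.rfl ?_
  filter_upwards [eventually_gt_atTop 0] with n hn
  rw [hc, Real.rpow_add (Nat.cast_pos.2 hn)]

lemma isBigO_natCast : (fun n : ℕ => (n : ℂ)) =O[atTop] fun n : ℕ => (n : ℝ) ^ (1 : ℝ) :=
  IsBigO.of_norm_le fun n => by simp

lemma isBigO_inv_add (z : ℂ) :
    (fun n : ℕ => (z + n)⁻¹) =O[atTop] fun n : ℕ => (n : ℝ) ^ (-1 : ℝ) := by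
  have h := (tendsto_add_nat_div z).inv₀ one_ne_zero
  refine isBigO_of_tendsto_mul_cpow (w := 1) (L := 1⁻¹) (h.congr fun n => ?_) (by simp)
  rw [inv_div, cpow_one, div_eq_mul_inv, mul_comm]

lemma isBigO_poch_div_factorial (s : ℂ) :
    (fun n : ℕ => poch s n / n !) =O[atTop] fun n : ℕ => (n : ℝ) ^ (s.re - 1) :=
  isBigO_of_tendsto_mul_cpow (tendsto_poch s) (by simp)

lemma isBigO_poch_mul_rGamma (s y : ℂ) :
    (fun n : ℕ => poch s n * rGamma (y + n)) =O[atTop] fun n : ℕ => (n : ℝ) ^ (s.re - y.re) := by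
  have hO := isBigO_of_tendsto_mul_cpow (tendsto_rGamma_add_nat y) rfl
  refine (isBigO_mul_rpow (isBigO_poch_div_factorial s) hO (by simp)).congr_left fun n => ?_
  field_simp [n.factorial_ne_zero]

lemma isBigO_Gamma_mul_rGamma (s y : ℂ) :
    (fun n : ℕ => Gamma (s + n) * rGamma (y + n)) =O[atTop]
      fun n : ℕ => (n : ℝ) ^ (s.re - y.re) := by
  refine (isBigO_mul_rpow (isBigO_of_tendsto_mul_cpow (tendsto_Gamma_add_nat s) rfl)
    (isBigO_of_tendsto_mul_cpow (tendsto_rGamma_add_nat y) rfl) (by simp)).congr_left fun n => ?_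
  field_simp [n.factorial_ne_zero]

lemma summable_of_isBigO_rpow {f : ℕ → ℂ} {a : ℝ} (hf : f =O[atTop] fun n : ℕ => (n : ℝ) ^ a)
    (ha : a < -1) : Summable f :=
  summable_of_isBigO_nat (Real.summable_nat_rpow.2 ha) hf

lemma tendsto_zero_of_isBigO_rpow {f : ℕ → ℂ} {a : ℝ}
    (hf : f =O[atTop] fun n : ℕ => (n : ℝ) ^ a) (ha : a < 0) : Tendsto f atTop (𝓝 0) := by
  refine hf.trans_tendsto ?_
  simpa only [neg_neg, Function.comp_def] using
    (tendsto_rpow_neg_atTop (neg_pos.2 ha)).comp tendsto_natCast_atTop_atTop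

lemma tendsto_Gamma_mul_rGamma_zero {x y : ℂ} (h : x.re < y.re) :
    Tendsto (fun N : ℕ => Gamma (x + N) * rGamma (y + N)) atTop (𝓝 0) :=
  tendsto_zero_of_isBigO_rpow (isBigO_Gamma_mul_rGamma x y) (sub_neg.2 h)

lemma tsum_eq_of_telescope {a X : ℕ → ℂ} {L : ℂ} (hs : Summable a)
    (h : ∀ l, a l = X (l + 1) - X l) (hX : Tendsto X atTop (𝓝 L)) : ∑' l, a l = L - X 0 := by
  refine tendsto_nhds_unique hs.hasSum.tendsto_sum_nat ?_
  simp_rw [h, Finset.sum_range_sub]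
  exact hX.sub_const _

/-! ### Inverse factorial series -/

lemma norm_le_norm_add_nat {z : ℂ} (hz : 0 ≤ z.re) (N : ℕ) : ‖z‖ ≤ ‖z + N‖ := by
  rw [← sq_le_sq₀ (norm_nonneg _) (norm_nonneg _), Complex.sq_norm, Complex.sq_norm,
    Complex.normSq_apply, Complex.normSq_apply]
  have : (0 : ℝ) ≤ N := Nat.cast_nonneg N
  simp only [add_re, natCast_re, add_im, natCast_im, add_zero]
  nlinarith

lemma norm_poch_le {y : ℂ} (hy : 0 ≤ y.re) (N l : ℕ) : ‖poch y l‖ ≤ ‖poch (y + N) l‖ := by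
  have hyj (j : ℕ) : 0 ≤ (y + j).re := by rw [add_re, natCast_re]; positivity
  simp_rw [← prod_range_add_eq_poch, norm_prod, add_right_comm y (N : ℂ)]
  gcongr with j
  exact norm_le_norm_add_nat (hyj j) N

lemma summable_rGamma_add_nat {q : ℕ → ℂ} {y : ℂ}
    (h : Summable fun l : ℕ => q l * rGamma (y + l)) (N : ℕ) :
    Summable fun l : ℕ => q l * rGamma (y + N + l) := by
  induction N with
  | zero => simpa using h
  | succ N ih =>
    refine ih.norm.of_norm_bounded_eventually_nat ?_
    filter_upwards [eventually_re_add_nat_pos (y + N - 1)] with l hl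
    have h1 : 1 ≤ ‖y + N + l‖ := by
      refine le_trans ?_ (re_le_norm _)
      simp only [sub_re, add_re, one_re] at hl ⊢
      linarith
    rw [rGamma_eq_mul (y + N + l), norm_mul, norm_mul, norm_mul, Nat.cast_succ, ← add_assoc,
      add_right_comm _ 1]
    gcongr
    exact le_mul_of_one_le_left (norm_nonneg _) h1

lemma tendsto_Gamma_mul_tsum_of_re_pos {q : ℕ → ℂ} {y : ℂ} (hy : 0 < y.re)
    (h : Summable fun l : ℕ => q l * rGamma (y + l)) :
    Tendsto (fun N : ℕ => Gamma (y + N) * ∑' l : ℕ, q l * rGamma (y + N + l)) atTop (𝓝 (q 0)) := by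
  have hy0 := ne_neg_nat_of_re_pos hy
  have hpoch (N l : ℕ) : Gamma (y + N) * (q l * rGamma (y + N + l)) = q l * (poch (y + N) l)⁻¹ := by
    rw [← Gamma_mul_rGamma_add_nat (add_nat_ne_neg_nat hy0 N)]
    ring
  have hterm (l : ℕ) : Tendsto (fun N : ℕ => Gamma (y + N) * (q l * rGamma (y + N + l))) atTop
      (𝓝 (if l = 0 then q 0 else 0)) := by
    rcases Nat.eq_zero_or_pos l with rfl | hl
    · simp_rw [hpoch, poch_zero, inv_one, mul_one, if_true]
      exact tendsto_const_nhds
    · have h0 := (tendsto_Gamma_mul_rGamma_zero (x := y) (y := y + l)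
        (by simpa using hl)).const_mul (q l)
      rw [mul_zero] at h0
      rw [if_neg hl.ne']
      exact h0.congr fun N => by rw [add_right_comm]; ring
  have hbound (N l : ℕ) :
      ‖Gamma (y + N) * (q l * rGamma (y + N + l))‖ ≤ ‖Gamma y * (q l * rGamma (y + l))‖ := by
    have h0 := hpoch 0 l
    rw [Nat.cast_zero, add_zero] at h0
    rw [hpoch, h0, norm_mul, norm_mul, norm_inv, norm_inv]
    have := norm_pos_iff.2 (poch_ne_zero hy0 l)
    gcongr
    exact norm_poch_le hy.le N l
  have := tendsto_tsum_of_dominated_convergence (h.mul_left (Gamma y)).norm hterm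
    (Eventually.of_forall hbound)
  simpa only [tsum_mul_left, tsum_ite_eq] using this

theorem tendsto_Gamma_mul_tsum {q : ℕ → ℂ} {y : ℂ}
    (h : Summable fun l : ℕ => q l * rGamma (y + l)) :
    Tendsto (fun N : ℕ => Gamma (y + N) * ∑' l : ℕ, q l * rGamma (y + N + l)) atTop (𝓝 (q 0)) := by
  obtain ⟨M, hM⟩ := (eventually_re_add_nat_pos y).exists
  have := tendsto_Gamma_mul_tsum_of_re_pos hM (summable_rGamma_add_nat h M)
  rw [← tendsto_add_atTop_iff_nat M]
  refine this.congr fun N => ?_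
  rw [Nat.cast_add, add_comm (N : ℂ), add_assoc]

lemma tendsto_Gamma_mul_tsum_zero {q : ℕ → ℂ} {x y : ℂ} (hxy : x.re < y.re)
    (h : Summable fun l : ℕ => q l * rGamma (y + l)) :
    Tendsto (fun N : ℕ => Gamma (x + N) * ∑' l : ℕ, q l * rGamma (y + N + l)) atTop (𝓝 0) := by
  have h0 := (tendsto_Gamma_mul_rGamma_zero hxy).mul (tendsto_Gamma_mul_tsum h)
  rw [zero_mul] at h0
  refine h0.congr' ?_
  filter_upwards [eventually_re_add_nat_pos y] with N hN
  linear_combination (Gamma (x + N) * ∑' l : ℕ, q l * rGamma (y + N + l)) *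
    Gamma_mul_rGamma_of_re_pos hN

/-! ### The coefficients `(-1)^l / (l! Γ(p - l))` -/

/-- The binomial coefficients `(-1)^l / (l! Γ(p - l)) = (1 - p)_l / (l! Γ(p))`, which vanish for
`p ≤ l` if `p` is an integer. -/
noncomputable def binomCoeff (p : ℂ) (l : ℕ) : ℂ := (-1) ^ l * rGamma (l + 1) * rGamma (p - l)

lemma binomCoeff_zero (p : ℂ) : binomCoeff p 0 = rGamma p := by simp [binomCoeff, rGamma_one]

lemma binomCoeff_succ (p : ℂ) (l : ℕ) :
    (l + 1) * binomCoeff p (l + 1) = -(p - 1 - l) * binomCoeff p l := by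
  rw [binomCoeff, binomCoeff, rGamma_eq_mul (l + 1), rGamma_eq_mul (p - (l + 1 : ℕ))]
  push_cast
  rw [show p - (l + 1) + 1 = p - l by ring, pow_succ]
  ring

lemma binomCoeff_add_one (p : ℂ) (l : ℕ) : (p - l) * binomCoeff (p + 1) l = binomCoeff p l := by
  rw [binomCoeff, binomCoeff, rGamma_eq_mul (p - l), show p + 1 - l = p - l + 1 by ring]
  ring

lemma binomCoeff_eq (p : ℂ) (l : ℕ) : binomCoeff p l = rGamma p * (poch (1 - p) l / l !) := by
  induction l with
  | zero => simp [binomCoeff_zero]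
  | succ l ih =>
    have h := binomCoeff_succ p l
    have h1 : (l + 1 : ℂ) ≠ 0 := Nat.cast_add_one_ne_zero l
    rw [← mul_right_inj' h1, h, ih, poch_succ, Nat.factorial_succ]
    push_cast
    field_simp [l.factorial_ne_zero]
    ring

lemma isBigO_binomCoeff (p : ℂ) :
    (fun n : ℕ => binomCoeff p n) =O[atTop] fun n : ℕ => (n : ℝ) ^ (-p.re) := by
  simp_rw [binomCoeff_eq]
  simpa using (isBigO_poch_div_factorial (1 - p)).const_mul_left (rGamma p)

lemma binomCoeff_intCast_eq_zero {n : ℤ} {l : ℕ} (hl : n ≤ l) : binomCoeff n l = 0 := by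
  obtain ⟨k, hk⟩ := Int.eq_ofNat_of_zero_le (sub_nonneg.2 hl)
  have hk' : (n : ℂ) - l = -k := by
    rw [← neg_sub]
    exact_mod_cast congrArg (fun z : ℤ => -(z : ℂ)) hk
  rw [binomCoeff, hk', rGamma_neg_nat, mul_zero]

/-- Either `p` is an integer or `a < Re p`. Under this condition the coefficients `binomCoeff p`
make a series with terms of order `n ^ (a - 1)` absolutely convergent, since they vanish eventually
if `p` is an integer and are of order `n ^ (-Re p)` in general. -/
def IntOrReGT (p : ℂ) (a : ℝ) : Prop := (∃ n : ℤ, p = n) ∨ a < p.re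

lemma IntOrReGT.mono {p : ℂ} {a b : ℝ} (h : IntOrReGT p a) (hba : b ≤ a) : IntOrReGT p b :=
  h.imp_right hba.trans_lt

lemma IntOrReGT.add_nat {p : ℂ} {a : ℝ} (h : IntOrReGT p a) (N : ℕ) :
    IntOrReGT (p + N) (a + N) := by
  refine h.imp (fun ⟨n, hn⟩ => ⟨n + N, by rw [hn]; push_cast; rfl⟩) fun h => ?_
  rw [add_re, natCast_re]
  linarith

lemma IntOrReGT.add_one {p : ℂ} {a : ℝ} (h : IntOrReGT p a) : IntOrReGT (p + 1) (a + 1) := by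
  simpa using h.add_nat 1

lemma exists_isBigO_mul_binomCoeff {f : ℕ → ℂ} {p : ℂ} {a : ℝ}
    (hf : f =O[atTop] fun n : ℕ => (n : ℝ) ^ a) (hp : IntOrReGT p (a + 1)) :
    ∃ b < (-1 : ℝ), (fun n => f n * binomCoeff p n) =O[atTop] fun n : ℕ => (n : ℝ) ^ b := by
  rcases hp with ⟨k, rfl⟩ | hp
  · refine ⟨-2, by norm_num, IsBigO.of_bound 0 ?_⟩
    filter_upwards [eventually_ge_atTop k.toNat] with n hn
    rw [binomCoeff_intCast_eq_zero (by lia), mul_zero, norm_zero, zero_mul]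
  · exact ⟨a - p.re, by linarith, isBigO_mul_rpow hf (isBigO_binomCoeff p) (sub_eq_add_neg _ _)⟩

lemma summable_mul_binomCoeff {f : ℕ → ℂ} {p : ℂ} {a : ℝ}
    (hf : f =O[atTop] fun n : ℕ => (n : ℝ) ^ a) (hp : IntOrReGT p (a + 1)) :
    Summable fun n => f n * binomCoeff p n := by
  obtain ⟨b, hb, hO⟩ := exists_isBigO_mul_binomCoeff hf hp
  exact summable_of_isBigO_rpow hO hb

/-! ### Gauss's summation theorem -/

/-- The Gauss series `₂F₁(x, 1 - p; y; 1) / (Γ(y) Γ(p))`. -/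
noncomputable def gaussSum (x y p : ℂ) : ℂ :=
  ∑' l : ℕ, poch x l * rGamma (y + l) * binomCoeff p l

section Gauss

variable {x y p : ℂ}

lemma summable_gaussSum (h : IntOrReGT p (x.re - y.re + 1)) :
    Summable fun l : ℕ => poch x l * rGamma (y + l) * binomCoeff p l :=
  summable_mul_binomCoeff (isBigO_poch_mul_rGamma x y) h

lemma IntOrReGT.gauss_add_one (h : IntOrReGT p (x.re - y.re + 1)) :
    IntOrReGT p (x.re - (y + 1).re + 1) :=
  h.mono (by rw [add_re, one_re]; linarith)

lemma gaussSum_contiguous (h : IntOrReGT p (x.re - y.re + 1)) :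
    (y - x + p - 1) * gaussSum x y p = (y - x) * (y + p - 1) * gaussSum x (y + 1) p := by
  obtain ⟨b, hb, hO⟩ := exists_isBigO_mul_binomCoeff (isBigO_poch_mul_rGamma x y) h
  have hs := (summable_gaussSum h).mul_left (y - x + p - 1)
  have hs' := (summable_gaussSum h.gauss_add_one).mul_left ((y - x) * (y + p - 1))
  have hX := (tendsto_zero_of_isBigO_rpow (isBigO_mul_rpow isBigO_natCast hO rfl)
    (by linarith)).neg
  rw [← sub_eq_zero, gaussSum, gaussSum, ← tsum_mul_left, ← tsum_mul_left, ← hs.tsum_sub hs',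
    tsum_eq_of_telescope (hs.sub hs') (fun l => ?_) hX]
  · simp
  · have h1 := binomCoeff_succ p l
    push_cast
    rw [poch_succ, rGamma_eq_mul (y + l), show y + (l + 1) = y + l + 1 by ring,
      show y + 1 + l = y + l + 1 by ring]
    linear_combination (poch x l * (x + l) * rGamma (y + l + 1)) * h1

lemma rGamma_mul_gaussSum_iterate (h : IntOrReGT p (x.re - y.re + 1)) (N : ℕ) :
    rGamma (y - x + p - 1) * gaussSum x y p
      = poch (y - x) N * poch (y + p - 1) N * rGamma (y - x + p - 1 + N) *
        gaussSum x (y + N) p := by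
  induction N generalizing y with
  | zero => simp
  | succ N ih =>
    have h1 := ih h.gauss_add_one
    have h2 := gaussSum_contiguous h
    rw [rGamma_eq_mul, poch_succ_left, poch_succ_left]
    push_cast
    rw [show y - x + p - 1 + 1 = y + 1 - x + p - 1 by ring,
      show y - x + 1 = y + 1 - x by ring, show y + p - 1 + 1 = y + 1 + p - 1 by ring,
      show y - x + p - 1 + (N + 1) = y + 1 - x + p - 1 + N by ring,
      show y + (N + 1 : ℂ) = y + 1 + N by ring]
    linear_combination rGamma (y + 1 - x + p - 1) * h2 + (y - x) * (y + p - 1) * h1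

lemma tendsto_Gamma_mul_gaussSum (h : IntOrReGT p (x.re - y.re + 1)) :
    Tendsto (fun N : ℕ => Gamma (y + N) * gaussSum x (y + N) p) atTop (𝓝 (rGamma p)) := by
  have hq : Summable fun l : ℕ => (poch x l * binomCoeff p l) * rGamma (y + l) :=
    (summable_gaussSum h).congr fun l => mul_right_comm _ _ _
  simpa only [gaussSum, mul_right_comm _ (binomCoeff p _), poch_zero, one_mul, binomCoeff_zero]
    using tendsto_Gamma_mul_tsum hq

lemma tendsto_poch_mul_poch {a b c d : ℂ} (habcd : a + b = c + d) :
    Tendsto (fun N : ℕ => poch a N * poch b N * (rGamma (c + N) * rGamma (d + N))) atTop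
      (𝓝 (rGamma a * rGamma b)) := by
  have h := ((tendsto_poch a).mul (tendsto_poch b)).mul
    ((tendsto_rGamma_add_nat c).mul (tendsto_rGamma_add_nat d))
  rw [mul_one, mul_one] at h
  refine h.congr' ?_
  filter_upwards [eventually_ne_atTop 0] with N hN
  have hN' : (N : ℂ) ≠ 0 := Nat.cast_ne_zero.2 hN
  have hpow : (N : ℂ) ^ (1 - a) * (N : ℂ) ^ (1 - b) * ((N : ℂ) ^ (c - 1) * (N : ℂ) ^ (d - 1))
      = 1 := by
    rw [← cpow_add _ _ hN', ← cpow_add _ _ hN', ← cpow_add _ _ hN',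
      show (1 - a) + (1 - b) + ((c - 1) + (d - 1)) = 0 by linear_combination -habcd, cpow_zero]
  field_simp [N.factorial_ne_zero]
  linear_combination (poch a N * poch b N * rGamma (c + N) * rGamma (d + N)) * hpow

theorem rGamma_mul_gaussSum (h : IntOrReGT p (x.re - y.re + 1)) :
    rGamma (y - x + p - 1) * gaussSum x y p = rGamma (y - x) * rGamma (y + p - 1) * rGamma p := by
  have hlim := (tendsto_poch_mul_poch (a := y - x) (b := y + p - 1) (c := y - x + p - 1) (d := y)
    (by ring)).mul (tendsto_Gamma_mul_gaussSum h)
  refine tendsto_nhds_unique (tendsto_const_nhds.congr' ?_) hlim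
  filter_upwards [eventually_re_add_nat_pos y] with N hN
  rw [rGamma_mul_gaussSum_iterate h N]
  linear_combination (-(poch (y - x) N * poch (y + p - 1) N * rGamma (y - x + p - 1 + N) *
    gaussSum x (y + N) p)) * Gamma_mul_rGamma_of_re_pos hN

end Gauss

lemma tsum_poch_div_factorial_mul_inv_add {q w : ℂ} (hq : q.re < 1) (hw : ∀ n : ℕ, w ≠ -n) :
    ∑' j : ℕ, poch q j / j ! * (w + j)⁻¹ = Gamma w * Gamma (1 - q) * rGamma (w + 1 - q) := by
  have hq' : 0 < (1 - q).re := by rw [sub_re, one_re]; linarith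
  have hterm (j : ℕ) : poch w j * rGamma (w + 1 + j) * binomCoeff (1 - q) j
      = rGamma (1 - q) * rGamma w * (poch q j / j ! * (w + j)⁻¹) := by
    have h0 := add_nat_ne_zero hw j
    rw [binomCoeff_eq, rGamma_eq_poch_mul w j, rGamma_eq_mul (w + j),
      show w + 1 + j = w + j + 1 by ring, sub_sub_cancel]
    field_simp
  have hG := rGamma_mul_gaussSum (x := w) (y := w + 1) (p := 1 - q)
    (Or.inr (by rw [add_re, one_re]; linarith))
  rw [gaussSum, tsum_congr hterm, tsum_mul_left, show w + 1 - w + (1 - q) - 1 = 1 - q by ring,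
    show w + 1 + (1 - q) - 1 = w + 1 - q by ring, add_sub_cancel_left, rGamma_one, one_mul] at hG
  have h1 := Gamma_mul_rGamma_of_re_pos hq'
  have h2 := Gamma_mul_rGamma hw
  have h3 : rGamma w * ∑' j : ℕ, poch q j / j ! * (w + j)⁻¹
      = Gamma (1 - q) * rGamma (w + 1 - q) := by
    refine mul_left_cancel₀ (rGamma_ne_zero (ne_neg_nat_of_re_pos hq')) ?_
    refine mul_left_cancel₀ (rGamma_ne_zero (ne_neg_nat_of_re_pos hq')) ?_
    linear_combination hG - rGamma (1 - q) * rGamma (w + 1 - q) * h1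
  linear_combination Gamma w * h3 - (∑' j : ℕ, poch q j / j ! * (w + j)⁻¹) * h2

lemma tsum_binomCoeff_mul_inv_add {p z : ℂ} (hp : 0 < p.re) (hz : ∀ n : ℕ, z ≠ -n) :
    ∑' l : ℕ, binomCoeff p l * (z + l)⁻¹ = Gamma z * rGamma (p + z) := by
  have h := tsum_poch_div_factorial_mul_inv_add (q := 1 - p) (by simpa using hp) hz
  rw [sub_sub_cancel, show z + 1 - (1 - p) = p + z by ring] at h
  simp_rw [binomCoeff_eq, mul_assoc, tsum_mul_left]
  rw [h]
  linear_combination (Gamma z * rGamma (p + z)) * Gamma_mul_rGamma_of_re_pos hp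

/-! ### The auxiliary series as a Newton series and its recurrences -/

/-- The coefficient of `binomCoeff p l` in the auxiliary series, in the parameters `p = m - 1` and
`g = f - 1` used from here on. -/
noncomputable def newtonCoeff (c g : ℂ) (l : ℕ) : ℂ :=
  poch (g + 1 - c) l * rGamma (2 - c + l) * (1 - c + l)⁻¹

/-- The sum of the auxiliary series, in which `p` enters through a Newton series only. -/
noncomputable def auxSum (c p g : ℂ) : ℂ := ∑' l : ℕ, newtonCoeff c g l * binomCoeff p l

section AuxSum

variable {c p g : ℂ}

lemma isBigO_newtonCoeff (c g : ℂ) :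
    newtonCoeff c g =O[atTop] fun n : ℕ => (n : ℝ) ^ (g.re - 2) :=
  isBigO_mul_rpow (isBigO_poch_mul_rGamma (g + 1 - c) (2 - c)) (isBigO_inv_add (1 - c)) (by
    simp only [sub_re, add_re, one_re, re_ofNat]
    ring)

lemma summable_auxSum (h : IntOrReGT p (g.re - 1)) :
    Summable fun l : ℕ => newtonCoeff c g l * binomCoeff p l :=
  summable_mul_binomCoeff (isBigO_newtonCoeff c g) (by convert h using 1; ring)

lemma IntOrReGT.gauss (h : IntOrReGT p g.re) (c : ℂ) :
    IntOrReGT p ((g + 1 - c).re - (2 - c).re + 1) := by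
  convert h using 1
  simp only [sub_re, add_re, one_re, re_ofNat]
  ring

lemma one_sub_add_nat_ne_zero (hc : c ∈ integerComplement) (l : ℕ) : 1 - c + l ≠ 0 :=
  add_nat_ne_zero (ne_neg_nat_of_mem_integerComplement (one_sub_mem_integerComplement hc)) l

lemma auxSum_add_one_right (hc : c ∈ integerComplement) (h : IntOrReGT p (g.re - 1)) :
    (p + 1 - c) * auxSum c (p + 1) g - auxSum c p g = gaussSum (g + 1 - c) (2 - c) (p + 1) := by
  have h' : IntOrReGT (p + 1) (g.re - 1) := h.add_one.mono (by linarith)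
  rw [auxSum, auxSum, gaussSum, ← tsum_mul_left,
    ← Summable.tsum_sub ((summable_auxSum h').mul_left _) (summable_auxSum h)]
  refine tsum_congr fun l => ?_
  have h0 := one_sub_add_nat_ne_zero hc l
  rw [newtonCoeff, ← binomCoeff_add_one p l]
  field_simp
  ring

lemma auxSum_param_add_one (hc : c ∈ integerComplement) (h : IntOrReGT p g.re) :
    (g + 1 - c) * auxSum c p (g + 1) = g * auxSum c p g + gaussSum (g + 1 - c) (2 - c) p := by
  have h1 : IntOrReGT p (g.re - 1) := h.mono (by linarith)
  rw [auxSum, auxSum, gaussSum, ← tsum_mul_left, ← tsum_mul_left,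
    ← Summable.tsum_add ((summable_auxSum h1).mul_left _) (summable_gaussSum (h.gauss c))]
  refine tsum_congr fun l => ?_
  have h0 := one_sub_add_nat_ne_zero hc l
  have h2 := (poch_succ_left (g + 1 - c) l).symm.trans (poch_succ _ l)
  rw [newtonCoeff, newtonCoeff, add_sub_right_comm (g + 1)]
  field_simp
  linear_combination (rGamma (2 - c + l) * binomCoeff p l) * h2

lemma newtonCoeff_succ_mul_binomCoeff_succ (hc : c ∈ integerComplement) (l : ℕ) :
    c * (newtonCoeff (c + 1) g (l + 1) * binomCoeff p (l + 1))
        + poch (g - c) (l + 1) * rGamma (1 - c + (l + 1 : ℕ)) * binomCoeff p (l + 1)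
      = (g - c) * (-(p - c) * (newtonCoeff c g l * binomCoeff p l)
        + poch (g + 1 - c) l * rGamma (2 - c + l) * binomCoeff p l) := by
  have h0 := one_sub_add_nat_ne_zero hc l
  have h1 := binomCoeff_succ p l
  rw [newtonCoeff, newtonCoeff]
  push_cast
  rw [show g + 1 - (c + 1) = g - c by ring, show 2 - (c + 1) + (l + 1) = 2 - c + l by ring,
    show 1 - c + (l + 1 : ℂ) = 2 - c + l by ring,
    show 1 - (c + 1) + (l + 1 : ℂ) = 1 - c + l by ring, poch_succ_left,
    show g - c + 1 = g + 1 - c by ring]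
  field_simp
  linear_combination ((g - c) * poch (g + 1 - c) l * rGamma (2 - c + l)) * h1

lemma auxSum_add_one_left (hc : c ∈ integerComplement) (h : IntOrReGT p g.re) :
    c * auxSum (c + 1) p g
      = (g - c) * (-(p - c) * auxSum c p g + gaussSum (g + 1 - c) (2 - c) p)
        - gaussSum (g - c) (1 - c) p := by
  have hU {c : ℂ} := summable_auxSum (c := c) (h.mono (sub_le_self g.re zero_le_one))
  have hG := summable_gaussSum (h.gauss (c + 1))
  rw [show g + 1 - (c + 1) = g - c by ring, show 2 - (c + 1) = 1 - c by ring] at hG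
  have hzero : c * (newtonCoeff (c + 1) g 0 * binomCoeff p 0)
      + poch (g - c) 0 * rGamma (1 - c + (0 : ℕ)) * binomCoeff p 0 = 0 := by
    have hc0 := integerComplement.ne_zero hc
    rw [newtonCoeff, poch_zero, poch_zero, Nat.cast_zero, add_zero, add_zero, add_zero,
      show 2 - (c + 1) = 1 - c by ring, show 1 - (c + 1) = -c by ring]
    field_simp
    ring
  rw [eq_sub_iff_add_eq, auxSum, auxSum, gaussSum, gaussSum, ← tsum_mul_left,
    ← Summable.tsum_add (hU.mul_left _) hG, ((hU.mul_left c).add hG).tsum_eq_zero_add, hzero,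
    zero_add, ← tsum_mul_left,
    ← Summable.tsum_add (hU.mul_left _) (summable_gaussSum (h.gauss c)), ← tsum_mul_left]
  exact tsum_congr (newtonCoeff_succ_mul_binomCoeff_succ hc)

end AuxSum

/-! ### The series `∑ (c)_l / (Γ(p+l) (g+l))` and its recurrences -/

/-- The series to which summation by parts reduces the digamma series. -/
noncomputable def pochSum (c p g : ℂ) : ℂ := ∑' l : ℕ, poch c l * rGamma (p + l) * (g + l)⁻¹

section PochSum

variable {c p g : ℂ}

lemma tendsto_poch_mul_rGamma_zero (hcp : c.re < p.re) :
    Tendsto (fun l : ℕ => poch c l * rGamma (p + l)) atTop (𝓝 0) :=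
  tendsto_zero_of_isBigO_rpow (isBigO_poch_mul_rGamma c p) (sub_neg.2 hcp)

lemma summable_pochSum (hcp : c.re < p.re) :
    Summable fun l : ℕ => poch c l * rGamma (p + l) * (g + l)⁻¹ :=
  summable_of_isBigO_rpow (isBigO_mul_rpow (isBigO_poch_mul_rGamma c p) (isBigO_inv_add g) rfl)
    (by linarith)

lemma poch_mul_rGamma_sub (c p : ℂ) (l : ℕ) :
    poch c l * rGamma (p + l) - poch c (l + 1) * rGamma (p + (l + 1 : ℕ))
      = (p - c) * (poch c l * rGamma (p + 1 + l)) := by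
  rw [poch_succ, rGamma_eq_mul (p + l), Nat.cast_succ, ← add_assoc, add_right_comm p 1]
  ring

lemma summable_poch_mul_rGamma (hcp : c.re < p.re) :
    Summable fun l : ℕ => poch c l * rGamma (p + 1 + l) :=
  summable_of_isBigO_rpow (isBigO_poch_mul_rGamma c (p + 1)) (by
    rw [add_re, one_re]
    linarith)

lemma tsum_poch_mul_rGamma (hcp : c.re < p.re) :
    ∑' l : ℕ, poch c l * rGamma (p + 1 + l) = rGamma p / (p - c) := by
  have h := tsum_eq_of_telescope ((summable_poch_mul_rGamma hcp).mul_left (p - c))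
    (X := fun l : ℕ => -(poch c l * rGamma (p + l)))
    (fun l => by rw [← poch_mul_rGamma_sub]; ring) (tendsto_poch_mul_rGamma_zero hcp).neg
  rw [tsum_mul_left] at h
  rw [eq_div_iff (ne_zero_of_re_pos (by rwa [sub_re, sub_pos])), mul_comm, h]
  simp

lemma pochSum_add_one_right (hg : g ∈ integerComplement) (hcp : c.re < p.re) :
    pochSum c p g = rGamma p / (p - c) + (p - g) * pochSum c (p + 1) g := by
  have hcp' : c.re < (p + 1).re := by rw [add_re, one_re]; linarith
  rw [← tsum_poch_mul_rGamma hcp, pochSum, pochSum, ← tsum_mul_left, ← Summable.tsum_add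
    (summable_poch_mul_rGamma hcp) ((summable_pochSum hcp').mul_left _)]
  refine tsum_congr fun l => ?_
  have h0 := add_nat_ne_zero (ne_neg_nat_of_mem_integerComplement hg) l
  rw [rGamma_eq_mul (p + l), add_right_comm p (l : ℂ)]
  field_simp
  ring

lemma pochSum_param_add_one (hg : g ∈ integerComplement) (hcp : c.re < p.re) :
    (p - g - 1) * pochSum c p g + (g + 1 - c) * pochSum c p (g + 1) = rGamma (p - 1) / g := by
  have hs := summable_pochSum (g := g) hcp
  have hs' := summable_pochSum (g := g + 1) hcp
  have hs1 := (summable_nat_add_iff 1).2 hs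
  have hterm (l : ℕ) :
      (p - g - 1) * (poch c (l + 1) * rGamma (p + (l + 1 : ℕ)) * (g + (l + 1 : ℕ))⁻¹)
        + (g + 1 - c) * (poch c l * rGamma (p + l) * (g + 1 + l)⁻¹)
      = -(poch c (l + 1) * rGamma (p + (l + 1 : ℕ))) - -(poch c l * rGamma (p + l)) := by
    have h0 := add_nat_ne_zero (ne_neg_nat_of_mem_integerComplement hg) (l + 1)
    push_cast at h0 ⊢
    rw [show g + (l + 1 : ℂ) = g + 1 + l by ring] at h0 ⊢
    rw [poch_succ, rGamma_eq_mul (p + l), ← add_assoc p]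
    field_simp
    ring
  have h := tsum_eq_of_telescope ((hs1.mul_left (p - g - 1)).add (hs'.mul_left (g + 1 - c)))
    hterm (tendsto_poch_mul_rGamma_zero hcp).neg
  have hg0 := integerComplement.ne_zero hg
  have hp := rGamma_eq_mul (p - 1)
  rw [Summable.tsum_add (hs1.mul_left _) (hs'.mul_left _), tsum_mul_left, tsum_mul_left] at h
  rw [sub_add_cancel] at hp
  rw [pochSum, pochSum, hs.tsum_eq_zero_add, hp]
  simp only [poch_zero, Nat.cast_zero, add_zero, one_mul, neg_zero, sub_neg_eq_add,
    zero_add] at h ⊢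
  linear_combination h - rGamma p * mul_inv_cancel₀ hg0

lemma pochSum_add_one_left (hg : g ∈ integerComplement) (hcp : c.re + 1 < p.re) :
    c * pochSum (c + 1) p g = rGamma (p - 1) / (p - 1 - c) + (c - g) * pochSum c p g := by
  have hcp2 : c.re < (p - 1).re := by rw [sub_re, one_re]; linarith
  have hs := summable_poch_mul_rGamma hcp2
  rw [← tsum_poch_mul_rGamma hcp2, pochSum, pochSum, ← tsum_mul_left, ← tsum_mul_left,
    ← Summable.tsum_add hs ((summable_pochSum (by linarith)).mul_left _)]
  refine tsum_congr fun l => ?_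
  have h0 := add_nat_ne_zero (ne_neg_nat_of_mem_integerComplement hg) l
  have h1 := (poch_succ_left c l).symm.trans (poch_succ c l)
  rw [sub_add_cancel]
  field_simp
  linear_combination rGamma (p + l) * h1

end PochSum

/-! ### The closed form -/

/-- The part of the closed form with a product of Gamma functions. -/
noncomputable def gammaPart (c p g : ℂ) : ℂ :=
  Gamma (1 + g) * Gamma (-g) * Gamma (1 - c) * rGamma (g + 1 - c) * rGamma (p - g)

/-- The part of the closed form with the auxiliary series. -/
noncomputable def auxPart (c p g : ℂ) : ℂ :=
  rGamma (p - g) * Gamma (1 - g) * Gamma (p + 1 - c) * auxSum c p g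

/-- The closed form of `pochSum c p g`. -/
noncomputable def closedForm (c p g : ℂ) : ℂ :=
  rGamma p / (p - c) - gammaPart c p g - auxPart c p g

/-- The defect of the evaluation of `pochSum` in closed form, which is shown to vanish. -/
noncomputable def defect (c p g : ℂ) : ℂ := pochSum c p g - closedForm c p g

section ClosedForm

variable {c p g : ℂ}

lemma sub_ne_zero_of_re_lt {z w : ℂ} (h : z.re < w.re) : w - z ≠ 0 :=
  ne_zero_of_re_pos (by rwa [sub_re, sub_pos])

lemma gammaPart_add_one_right (c p g : ℂ) :
    gammaPart c p g = (p - g) * gammaPart c (p + 1) g := by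
  rw [gammaPart, gammaPart, rGamma_eq_mul (p - g), sub_add_eq_add_sub]
  ring

lemma gammaPart_param_add_one (c p : ℂ) (hg : g ∈ integerComplement) :
    (p - g - 1) * gammaPart c p g + (g + 1 - c) * gammaPart c p (g + 1) = 0 := by
  have hg1 : 1 + g ≠ 0 := by
    rw [add_comm]
    exact integerComplement.ne_zero (add_one_mem_integerComplement.2 hg)
  have h1 := Gamma_add_one (1 + g) hg1
  have h2 := Gamma_add_one (-(g + 1)) (by rwa [neg_ne_zero, add_comm])
  have h3 := rGamma_eq_mul (g + 1 - c)
  have h4 := rGamma_eq_mul (p - (g + 1))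
  rw [show -(g + 1) + 1 = -g by ring] at h2
  rw [show p - (g + 1) + 1 = p - g by ring] at h4
  rw [gammaPart, gammaPart, h2, h3, h4, show 1 + (g + 1) = 1 + g + 1 by ring, h1,
    show g + 1 + 1 - c = g + 1 - c + 1 by ring]
  ring

lemma gammaPart_add_one_left (hc : c ∈ integerComplement) (p g : ℂ) :
    c * gammaPart (c + 1) p g = (c - g) * gammaPart c p g := by
  have h1 := Gamma_add_one (-c) (neg_ne_zero.2 (integerComplement.ne_zero hc))
  have h2 := rGamma_eq_mul (g - c)
  rw [gammaPart, gammaPart, show 1 - (c + 1) = -c by ring, show 1 - c = -c + 1 by ring, h1,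
    show g + 1 - (c + 1) = g - c by ring, h2, show g - c + 1 = g + 1 - c by ring]
  ring

lemma Gamma_mul_gaussSum (hg : g ∈ integerComplement) (hcp : c.re < p.re + 1)
    (h : IntOrReGT p g.re) :
    rGamma (p - g) * Gamma (1 - g) * Gamma (p + 1 - c) * gaussSum (g + 1 - c) (2 - c) p
      = rGamma p := by
  have hG := rGamma_mul_gaussSum (h.gauss c)
  have h1 := Gamma_mul_rGamma
    (ne_neg_nat_of_mem_integerComplement (one_sub_mem_integerComplement hg))
  have h2 := Gamma_mul_rGamma_of_re_pos (z := p + 1 - c) (by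
    rw [sub_re, add_re, one_re]
    linarith)
  rw [show 2 - c - (g + 1 - c) + p - 1 = p - g by ring, show 2 - c - (g + 1 - c) = 1 - g by ring,
    show 2 - c + p - 1 = p + 1 - c by ring] at hG
  linear_combination (Gamma (1 - g) * Gamma (p + 1 - c)) * hG
    + Gamma (1 - g) * rGamma (1 - g) * rGamma p * h2 + rGamma p * h1

lemma auxPart_add_one_right (hc : c ∈ integerComplement) (hg : g ∈ integerComplement)
    (hcp : c.re < p.re) (h : IntOrReGT p (g.re - 1)) :
    (p - g) * auxPart c (p + 1) g - auxPart c p g = (p - g) * (rGamma (p + 1) / (p + 1 - c)) := by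
  have hU := auxSum_add_one_right hc h
  have hcp1 : c.re < (p + 1).re := by rw [add_re, one_re]; linarith
  have hG := Gamma_mul_gaussSum (c := c) hg (hcp1.trans (lt_add_one _))
    (by simpa using h.add_one)
  have hne := sub_ne_zero_of_re_lt hcp1
  rw [show p + 1 + 1 - c = p + 1 - c + 1 by ring, Gamma_add_one _ hne] at hG
  rw [auxPart, auxPart, rGamma_eq_mul (p - g), sub_add_eq_add_sub,
    show p + 1 + 1 - c = p + 1 - c + 1 by ring, Gamma_add_one _ hne, ← hG]
  field_simp
  linear_combination (p - g) * rGamma (p + 1 - g) * Gamma (1 - g) * Gamma (p + 1 - c) * hU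

lemma auxPart_param_add_one (hc : c ∈ integerComplement) (hg : g ∈ integerComplement)
    (hcp : c.re < p.re) (h : IntOrReGT p g.re) :
    -g * ((g + 1 - c) * auxPart c p (g + 1)) = (p - g - 1) * (g * auxPart c p g + rGamma p) := by
  have hU := auxSum_param_add_one hc h
  have hG := Gamma_mul_gaussSum hg (hcp.trans (lt_add_one _)) h
  have hΓ := Gamma_add_one (-g) (neg_ne_zero.2 (integerComplement.ne_zero hg))
  have hr := rGamma_eq_mul (p - (g + 1))
  rw [show p - (g + 1) + 1 = p - g by ring] at hr
  rw [show 1 - g = -g + 1 by ring, hΓ] at hG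
  rw [auxPart, auxPart, hr, show 1 - (g + 1) = -g by ring, show 1 - g = -g + 1 by ring, hΓ, ← hG]
  linear_combination
    (p - g - 1) * rGamma (p - g) * (-g * Gamma (-g)) * Gamma (p + 1 - c) * hU

lemma auxPart_add_one_left (hc : c ∈ integerComplement) (hg : g ∈ integerComplement)
    (hcp : c.re < p.re) (h : IntOrReGT p g.re) :
    c * auxPart (c + 1) p g = (g - c) * (-auxPart c p g + rGamma p / (p - c)) - rGamma p := by
  have hU := auxSum_add_one_left hc h
  have hG := Gamma_mul_gaussSum hg (hcp.trans (lt_add_one _)) h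
  have hG' := Gamma_mul_gaussSum (c := c + 1) hg
    (by rw [add_re, one_re]; linarith) h
  have hne := sub_ne_zero_of_re_lt hcp
  have hΓ := Gamma_add_one (p - c) hne
  rw [sub_add_eq_add_sub] at hΓ
  rw [show g + 1 - (c + 1) = g - c by ring, show 2 - (c + 1) = 1 - c by ring,
    add_sub_add_right_eq_sub] at hG'
  have hG₀ : rGamma p / (p - c)
      = rGamma (p - g) * Gamma (1 - g) * Gamma (p - c) * gaussSum (g + 1 - c) (2 - c) p := by
    rw [← hG, hΓ]
    field_simp
  rw [hG₀, auxPart, auxPart, hΓ, add_sub_add_right_eq_sub]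
  linear_combination rGamma (p - g) * Gamma (1 - g) * Gamma (p - c) * hU - hG'

lemma defect_add_one_right (hc : c ∈ integerComplement) (hg : g ∈ integerComplement)
    (hcp : c.re < p.re) (h : IntOrReGT p (g.re - 1)) :
    defect c p g = (p - g) * defect c (p + 1) g := by
  rw [defect, defect, closedForm, closedForm, pochSum_add_one_right hg hcp,
    gammaPart_add_one_right]
  linear_combination -auxPart_add_one_right hc hg hcp h

lemma defect_param_add_one (hc : c ∈ integerComplement) (hg : g ∈ integerComplement)
    (hcp : c.re < p.re) (h : IntOrReGT p g.re) :
    (p - g - 1) * defect c p g + (g + 1 - c) * defect c p (g + 1) = 0 := by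
  have hg0 := integerComplement.ne_zero hg
  have hB : (p - g - 1) * auxPart c p g + (g + 1 - c) * auxPart c p (g + 1)
      = -((p - g - 1) * rGamma p / g) := by
    field_simp
    linear_combination -auxPart_param_add_one hc hg hcp h
  have hp := rGamma_eq_mul (p - 1)
  rw [sub_add_cancel] at hp
  have hS := pochSum_param_add_one hg hcp
  have hlast := div_mul_cancel₀ (rGamma p) (sub_ne_zero_of_re_lt hcp)
  have hsplit : (p - 1) * rGamma p / g = rGamma p + (p - g - 1) * rGamma p / g := by
    field_simp
    ring
  rw [hp, hsplit] at hS
  rw [defect, defect, closedForm, closedForm]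
  linear_combination hS + gammaPart_param_add_one c p hg + hB - hlast

lemma defect_add_one_left (hc : c ∈ integerComplement) (hg : g ∈ integerComplement)
    (hcp : c.re + 1 < p.re) (h : IntOrReGT p g.re) :
    c * defect (c + 1) p g = (c - g) * defect c p g := by
  have hne : p - 1 - c ≠ 0 := sub_ne_zero_of_re_lt (by rw [sub_re, one_re]; linarith)
  have hS := pochSum_add_one_left hg hcp
  have hB := auxPart_add_one_left hc hg (by linarith) h
  have hp := rGamma_eq_mul (p - 1)
  rw [sub_add_cancel] at hp
  have hlast : (p - 1) * rGamma p / (p - 1 - c) - rGamma p = c * (rGamma p / (p - (c + 1))) := by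
    rw [show p - (c + 1) = p - 1 - c by ring]
    field_simp
    ring
  rw [hp] at hS
  rw [defect, defect, closedForm, closedForm]
  linear_combination hS + gammaPart_add_one_left hc p g + hB + hlast

end ClosedForm

/-! ### Partial fractions of the coefficients -/

/-- Up to the factor `-1 / Γ(1-g)`, the residue of `z ↦ Γ(g+z) / (z Γ(1+z))` at `z = -g-j`. -/
noncomputable def residueCoeff (g : ℂ) (j : ℕ) : ℂ := poch g j / j ! * (g + j)⁻¹

lemma isBigO_residueCoeff (g : ℂ) :
    residueCoeff g =O[atTop] fun n : ℕ => (n : ℝ) ^ (g.re - 2) :=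
  isBigO_mul_rpow (isBigO_poch_div_factorial g) (isBigO_inv_add g) (by ring)

lemma summable_residueCoeff_mul_inv_add {g : ℂ} (hg2 : g.re < 2) (x : ℂ) :
    Summable fun j : ℕ => residueCoeff g j * (x + j)⁻¹ :=
  summable_of_isBigO_rpow (isBigO_mul_rpow (isBigO_residueCoeff g) (isBigO_inv_add x) rfl)
    (by linarith)

lemma summable_poch_div_factorial_mul_inv_add {q : ℂ} (hq : q.re < 1) (w : ℂ) :
    Summable fun j : ℕ => poch q j / j ! * (w + j)⁻¹ :=
  summable_of_isBigO_rpow (isBigO_mul_rpow (isBigO_poch_div_factorial q) (isBigO_inv_add w) rfl)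
    (by linarith)

lemma residueCoeff_mul_inv_add {g z : ℂ} (hg : g ∈ integerComplement) (hz : z ≠ 0)
    (hgz : ∀ n : ℕ, g + z ≠ -n) (j : ℕ) :
    residueCoeff g j * (g + z + j)⁻¹ = (g - 1)⁻¹ *
      (-z⁻¹ * (poch (g - 1) j / j ! * (g + j)⁻¹)
        + (1 + z) * z⁻¹ * (poch (g - 1) j / j ! * (g + z + j)⁻¹)) := by
  have h1 := add_nat_ne_zero (ne_neg_nat_of_mem_integerComplement hg) j
  have h2 := add_nat_ne_zero hgz j
  have h3 : g - 1 ≠ 0 := by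
    rw [← neg_ne_zero, neg_sub]
    exact integerComplement.ne_zero (one_sub_mem_integerComplement hg)
  have h4 := (poch_succ_left (g - 1) j).symm.trans (poch_succ _ j)
  rw [sub_add_cancel] at h4
  rw [residueCoeff, ← inv_mul_cancel_left₀ h3 (poch g j), h4]
  field_simp
  ring

lemma Gamma_mul_rGamma_mul_inv_eq_tsum {g z : ℂ} (hg : g ∈ integerComplement) (hg2 : g.re < 2)
    (hz : z ≠ 0) (hgz : ∀ n : ℕ, g + z ≠ -n) :
    Gamma (g + z) * rGamma (1 + z) * z⁻¹
      = Gamma g * z⁻¹ - rGamma (1 - g) * ∑' j : ℕ, residueCoeff g j * (g + z + j)⁻¹ := by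
  have hq : (g - 1).re < 1 := by rw [sub_re, one_re]; linarith
  have hq0 : g - 1 ≠ 0 := by
    rw [← neg_ne_zero, neg_sub]
    exact integerComplement.ne_zero (one_sub_mem_integerComplement hg)
  have h1 : rGamma 2 = 1 := by rw [← one_mul (rGamma 2), ← one_add_one_eq_two, ← rGamma_eq_mul,
    rGamma_one]
  have h2 : Gamma (2 - g) * rGamma (2 - g) = 1 :=
    Gamma_mul_rGamma (ne_neg_nat_of_mem_integerComplement
      (by simpa using intCast_sub_mem_integerComplement hg 2))
  simp_rw [residueCoeff_mul_inv_add hg hz hgz]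
  rw [tsum_mul_left,
    Summable.tsum_add ((summable_poch_div_factorial_mul_inv_add hq g).mul_left _)
      ((summable_poch_div_factorial_mul_inv_add hq (g + z)).mul_left _),
    tsum_mul_left, tsum_mul_left,
    tsum_poch_div_factorial_mul_inv_add hq (ne_neg_nat_of_mem_integerComplement hg),
    tsum_poch_div_factorial_mul_inv_add hq hgz, show 1 - (g - 1) = 2 - g by ring,
    show g + 1 - (g - 1) = 2 by ring, show g + z + 1 - (g - 1) = 1 + z + 1 by ring,
    rGamma_eq_mul (1 + z), rGamma_eq_mul (1 - g), show 1 - g + 1 = 2 - g by ring, h1]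
  field_simp
  linear_combination ((g - 1) * (Gamma g - (1 + z) * Gamma (g + z) * rGamma (1 + z + 1))) * h2

section DoubleSeries

variable {q : ℕ → ℂ} {p x : ℂ} (hp : 1 < p.re) (hx : 0 < x.re)
  (hq : Summable fun j : ℕ => q j * (x + j)⁻¹)

include hp hx hq

lemma summable_mul_inv_add_mul_binomCoeff :
    Summable fun i : ℕ × ℕ => q i.2 * (x + i.1 + i.2)⁻¹ * binomCoeff p i.1 := by
  have hβ : Summable (binomCoeff p) :=
    summable_of_isBigO_rpow (isBigO_binomCoeff p) (by linarith)
  have hinv (l j : ℕ) : ‖(x + l + j)⁻¹‖ ≤ ‖(x + j)⁻¹‖ := by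
    have hxj : 0 ≤ (x + j).re := by rw [add_re, natCast_re]; positivity
    have hpos := norm_pos_iff.2 (add_nat_ne_zero (ne_neg_nat_of_re_pos hx) j)
    rw [norm_inv, norm_inv, add_right_comm]
    exact inv_anti₀ hpos (norm_le_norm_add_nat hxj l)
  refine Summable.of_norm_bounded (summable_mul_of_summable_norm hβ.norm hq.norm).norm
    fun i => ?_
  calc ‖q i.2 * (x + i.1 + i.2)⁻¹ * binomCoeff p i.1‖
      = ‖binomCoeff p i.1‖ * (‖q i.2‖ * ‖(x + i.1 + i.2)⁻¹‖) := by
        rw [norm_mul, norm_mul, mul_comm]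
    _ ≤ ‖binomCoeff p i.1‖ * (‖q i.2‖ * ‖(x + i.2)⁻¹‖) := by
        gcongr
        exact hinv i.1 i.2
    _ = ‖binomCoeff p i.1 * (q i.2 * (x + i.2)⁻¹)‖ := by rw [norm_mul, norm_mul]

lemma hasSum_tsum_mul_inv_add_mul_binomCoeff :
    HasSum (fun l : ℕ => (∑' j : ℕ, q j * (x + l + j)⁻¹) * binomCoeff p l)
      (∑' j : ℕ, q j * (Gamma (x + j) * rGamma (p + (x + j)))) := by
  have hs := summable_mul_inv_add_mul_binomCoeff hp hx hq
  have hcol (j : ℕ) : ∑' l : ℕ, q j * (x + l + j)⁻¹ * binomCoeff p l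
      = q j * (Gamma (x + j) * rGamma (p + (x + j))) := by
    rw [← tsum_binomCoeff_mul_inv_add (by linarith)
      (add_nat_ne_neg_nat (ne_neg_nat_of_re_pos hx) j), ← tsum_mul_left]
    exact tsum_congr fun l => by rw [add_right_comm]; ring
  simp_rw [← hcol, ← tsum_mul_right]
  rw [Summable.tsum_comm (f := fun l j : ℕ => q j * (x + l + j)⁻¹ * binomCoeff p l) hs]
  exact hs.prod.hasSum

end DoubleSeries

/-! ### The base strip `0 < Re g < 2` -/

/-- The series that results when the partial fractions of the coefficients are summed against
`binomCoeff p`. -/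
noncomputable def residueSum (c p g : ℂ) : ℂ :=
  ∑' j : ℕ, residueCoeff g j * (Gamma (g + 1 - c + j) * rGamma (p + (g + 1 - c + j)))

section Strip

variable {c p g : ℂ}

lemma newtonCoeff_eq_tsum (hc : c ∈ integerComplement) (hg : g ∈ integerComplement)
    (hcg : c.re < g.re) (hg2 : g.re < 2) (l : ℕ) :
    newtonCoeff c g l = rGamma (g + 1 - c) * (Gamma g * (1 - c + l)⁻¹
      - rGamma (1 - g) * ∑' j : ℕ, residueCoeff g j * (g + 1 - c + l + j)⁻¹) := by
  have hx : 0 < (g + 1 - c).re := by rw [sub_re, add_re, one_re]; linarith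
  have hx0 := ne_neg_nat_of_re_pos hx
  have h1 := Gamma_mul_rGamma_mul_inv_eq_tsum hg hg2 (one_sub_add_nat_ne_zero hc l) (fun n => by
    rw [show g + (1 - c + l) = g + 1 - c + l by ring]
    exact add_nat_ne_neg_nat hx0 l n)
  rw [show g + (1 - c + l) = g + 1 - c + l by ring,
    show 1 + (1 - c + (l : ℂ)) = 2 - c + l by ring] at h1
  rw [newtonCoeff, poch_eq_Gamma_mul_rGamma hx0]
  linear_combination rGamma (g + 1 - c) * h1

lemma auxSum_eq_residueSum (hc : c ∈ integerComplement) (hg : g ∈ integerComplement)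
    (hcg : c.re < g.re) (hg2 : g.re < 2) (hp : 1 < p.re) :
    auxSum c p g = rGamma (g + 1 - c) * (Gamma g * (Gamma (1 - c) * rGamma (p + 1 - c))
      - rGamma (1 - g) * residueSum c p g) := by
  have hc1 := ne_neg_nat_of_mem_integerComplement (one_sub_mem_integerComplement hc)
  have hs : Summable fun l : ℕ => binomCoeff p l * (1 - c + l)⁻¹ :=
    summable_of_isBigO_rpow (isBigO_mul_rpow (isBigO_binomCoeff p) (isBigO_inv_add (1 - c)) rfl)
      (by linarith)
  have hpole := hs.hasSum
  rw [tsum_binomCoeff_mul_inv_add (by linarith) hc1, add_sub] at hpole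
  have hrest := hasSum_tsum_mul_inv_add_mul_binomCoeff (x := g + 1 - c) hp
    (by rw [sub_re, add_re, one_re]; linarith) (summable_residueCoeff_mul_inv_add hg2 _)
  have h := ((hpole.mul_left (Gamma g)).sub (hrest.mul_left (rGamma (1 - g)))).mul_left
    (rGamma (g + 1 - c))
  rw [← residueSum] at h
  refine Eq.trans (tsum_congr fun l => ?_) h.tsum_eq
  rw [newtonCoeff_eq_tsum hc hg hcg hg2]
  ring

lemma gammaPart_add_auxPart (hc : c ∈ integerComplement) (hg : g ∈ integerComplement)
    (hcg : c.re < g.re) (hg0 : 0 < g.re) (hg2 : g.re < 2) (hp : g.re + 1 < p.re) :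
    gammaPart c p g + auxPart c p g
      = -(rGamma (p - g) * (rGamma (g + 1 - c) * (Gamma (p + 1 - c) * residueSum c p g))) := by
  have h1 := Gamma_add_one g (integerComplement.ne_zero hg)
  have h2 := Gamma_add_one (-g) (neg_ne_zero.2 (integerComplement.ne_zero hg))
  have h3 := Gamma_mul_rGamma
    (ne_neg_nat_of_mem_integerComplement (one_sub_mem_integerComplement hg))
  have h4 := Gamma_mul_rGamma_of_re_pos (z := p + 1 - c) (by
    rw [sub_re, add_re, one_re]
    linarith)
  rw [neg_add_eq_sub] at h2
  rw [h2] at h3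
  rw [gammaPart, auxPart, auxSum_eq_residueSum hc hg hcg hg2 (by linarith), add_comm 1 g, h1, h2]
  linear_combination
    -rGamma (p - g) * rGamma (g + 1 - c) * Gamma (p + 1 - c) * residueSum c p g * h3
    - g * Gamma g * Gamma (-g) * Gamma (1 - c) * rGamma (g + 1 - c) * rGamma (p - g) * h4

lemma Gamma_mul_defect_eq (hc : c ∈ integerComplement) (hg : g ∈ integerComplement)
    (hcg : c.re < g.re) (hg0 : 0 < g.re) (hg2 : g.re < 2) (hp : g.re + 1 < p.re) :
    Gamma (p - g) * defect c p g = Gamma (p + 1 - g) * pochSum c (p + 1) g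
      - rGamma (g + 1 - c) * (Gamma (p + 1 - c) * residueSum c p g) := by
  have hpg : 0 < (p - g).re := by rw [sub_re]; linarith
  have hΓ := Gamma_add_one (p - g) (ne_zero_of_re_pos hpg)
  rw [sub_add_eq_add_sub] at hΓ
  rw [defect, closedForm, pochSum_add_one_right hg (by linarith), hΓ]
  linear_combination Gamma (p - g) * gammaPart_add_auxPart hc hg hcg hg0 hg2 hp
    - rGamma (g + 1 - c) * (Gamma (p + 1 - c) * residueSum c p g)
      * Gamma_mul_rGamma_of_re_pos hpg

lemma defect_iterate_add_one_right (hc : c ∈ integerComplement) (hg : g ∈ integerComplement)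
    (hcp : c.re < p.re) (h : IntOrReGT p (g.re - 1)) (N : ℕ) :
    defect c p g = poch (p - g) N * defect c (p + N) g := by
  induction N with
  | zero => simp
  | succ N ih =>
    have hcp' : c.re < (p + N).re := by rw [add_re, natCast_re]; linarith [N.cast_nonneg (α := ℝ)]
    rw [ih, defect_add_one_right hc hg hcp' ((h.add_nat N).mono (by simp)), poch_succ,
      Nat.cast_succ, ← add_assoc, sub_add_eq_add_sub]
    ring

lemma tendsto_Gamma_mul_pochSum (hg0 : 0 < g.re) (hcp : c.re < p.re) :
    Tendsto (fun N : ℕ => Gamma (p - g + N) * pochSum c (p + N) g) atTop (𝓝 0) := by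
  simp_rw [pochSum, mul_right_comm _ (rGamma _)]
  exact tendsto_Gamma_mul_tsum_zero (by rw [sub_re]; linarith)
    ((summable_pochSum hcp).congr fun l => mul_right_comm _ _ _)

lemma tendsto_Gamma_mul_residueSum (hg0 : 0 < g.re) (hp : g.re - 1 < p.re) :
    Tendsto (fun N : ℕ => Gamma (p + 1 - c + N) * residueSum c (p + N) g) atTop (𝓝 0) := by
  have hs : Summable fun j : ℕ =>
      residueCoeff g j * Gamma (g + 1 - c + j) * rGamma (p + (g + 1 - c) + j) := by
    refine (summable_of_isBigO_rpow (isBigO_mul_rpow (isBigO_residueCoeff g)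
      (isBigO_Gamma_mul_rGamma (g + 1 - c) (p + (g + 1 - c))) rfl) ?_).congr fun j => by ring
    rw [add_re p]
    linarith
  refine (tendsto_Gamma_mul_tsum_zero (x := p + 1 - c) ?_ hs).congr fun N => ?_
  · simp only [add_re, sub_re]
    linarith
  · rw [residueSum]
    congr 1
    refine tsum_congr fun j => ?_
    rw [show p + N + (g + 1 - c + j) = p + (g + 1 - c) + N + j by ring]
    ring

lemma defect_eq_zero_of_strip (hc : c ∈ integerComplement) (hg : g ∈ integerComplement)
    (hcg : c.re < g.re) (hg0 : 0 < g.re) (hg2 : g.re < 2) (hp : g.re + 1 < p.re) :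
    defect c p g = 0 := by
  have hpg : 0 < (p - g).re := by rw [sub_re]; linarith
  have hpg0 := ne_neg_nat_of_re_pos hpg
  have hS := tendsto_Gamma_mul_pochSum (c := c) (p := p + 1) hg0 (by rw [add_re, one_re]; linarith)
  have hR := (tendsto_Gamma_mul_residueSum (c := c) (p := p) hg0 (by linarith)).const_mul
    (rGamma (g + 1 - c))
  have hlim := hS.sub hR
  rw [mul_zero, sub_zero] at hlim
  have hperiodic (N : ℕ) : Gamma (p + 1 - g + N) * pochSum c (p + 1 + N) g
      - rGamma (g + 1 - c) * (Gamma (p + 1 - c + N) * residueSum c (p + N) g)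
      = Gamma (p - g) * defect c p g := by
    have hN : p.re ≤ (p + N).re := by simp
    have hD : defect c p g = poch (p - g) N * defect c (p + N) g :=
      defect_iterate_add_one_right hc hg (by linarith) (Or.inr (by linarith)) N
    have hG := Gamma_mul_defect_eq hc hg hcg hg0 hg2 (p := p + N) (by linarith)
    rw [show p + N - g = p - g + N by ring, Gamma_add_nat hpg0] at hG
    rw [add_right_comm p N, add_sub_right_comm (p + 1), add_sub_right_comm (p + 1)] at hG
    linear_combination -hG - Gamma (p - g) * hD
  simp_rw [hperiodic] at hlim
  exact (mul_eq_zero.1 (tendsto_nhds_unique tendsto_const_nhds hlim)).resolve_left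
    (Gamma_ne_zero hpg0)

end Strip

/-! ### The evaluation for all parameters -/

/-- The evaluation of `pochSum` in closed form, for all `c` and `p` that are admissible for `g`. -/
def DefectVanishes (g : ℂ) : Prop :=
  ∀ c ∈ integerComplement, ∀ p : ℂ, c.re < p.re → IntOrReGT p (g.re - 1) → defect c p g = 0

section Continuation

variable {g : ℂ} (hg : g ∈ integerComplement)

include hg

lemma defect_eq_zero_of_re_lt_add_nat {p : ℂ} (hp : g.re + 1 < p.re)
    (h : ∀ c ∈ integerComplement, c.re < g.re → defect c p g = 0) (M : ℕ) :
    ∀ c ∈ integerComplement, c.re < p.re → c.re < g.re + M → defect c p g = 0 := by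
  induction M with
  | zero => exact fun c hc _ hcM => h c hc (by simpa using hcM)
  | succ M ih =>
    intro c hc hcp hcM
    have hc' : c - 1 ∈ integerComplement := by
      rwa [← add_one_mem_integerComplement, sub_add_cancel]
    have hre : (c - 1).re = c.re - 1 := by rw [sub_re, one_re]
    push_cast at hcM
    have hrec := defect_add_one_left hc' hg (p := p) (by linarith) (Or.inr (by linarith))
    rw [ih _ hc' (by linarith) (by linarith), sub_add_cancel, mul_zero] at hrec
    exact (mul_eq_zero.1 hrec).resolve_left (integerComplement.ne_zero hc')

lemma DefectVanishes.of_re_lt (h : ∀ c ∈ integerComplement, ∀ p : ℂ,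
    c.re < g.re → g.re + 1 < p.re → defect c p g = 0) : DefectVanishes g := by
  intro c hc p hcp hp
  obtain ⟨N, hN⟩ := (eventually_re_add_nat_pos (p - g - 1)).exists
  obtain ⟨M, hM⟩ := exists_nat_gt (c.re - g.re)
  have hpN : g.re + 1 < (p + N).re := by
    simp only [add_re, sub_re, one_re] at hN ⊢
    linarith
  have hcN : c.re < (p + N).re := by
    rw [add_re, natCast_re]
    linarith [N.cast_nonneg (α := ℝ)]
  rw [defect_iterate_add_one_right hc hg hcp hp N,
    defect_eq_zero_of_re_lt_add_nat hg hpN (fun c hc hcg => h c hc _ hcg hpN) M c hc hcN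
      (by linarith), mul_zero]

lemma defectVanishes_add_one_iff : DefectVanishes (g + 1) ↔ DefectVanishes g := by
  have hre : (g + 1).re = g.re + 1 := by rw [add_re, one_re]
  refine ⟨fun h => .of_re_lt hg fun c hc p hcg hp => ?_,
    fun h => .of_re_lt (add_one_mem_integerComplement.2 hg) fun c hc p hcg hp => ?_⟩
  · have hrec := defect_param_add_one hc hg (p := p) (by linarith) (Or.inr (by linarith))
    rw [h c hc p (by linarith) (Or.inr (by linarith)), mul_zero, add_zero, sub_sub] at hrec
    exact (mul_eq_zero.1 hrec).resolve_left (sub_ne_zero_of_re_lt (by linarith))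
  · have hrec := defect_param_add_one hc hg (p := p) (by linarith) (Or.inr (by linarith))
    rw [h c hc p (by linarith) (Or.inr (by linarith)), mul_zero, zero_add] at hrec
    exact (mul_eq_zero.1 hrec).resolve_left (sub_ne_zero_of_re_lt hcg)

lemma defectVanishes_add_int_iff (k : ℤ) : DefectVanishes (g + k) ↔ DefectVanishes g := by
  induction k with
  | zero => simp
  | succ k ih =>
    rw [← ih, ← defectVanishes_add_one_iff ((add_intCast_mem_integerComplement k).2 hg), add_assoc]
    push_cast
    rfl
  | pred k ih =>
    rw [← ih, ← defectVanishes_add_one_iff ((add_intCast_mem_integerComplement (-k - 1)).2 hg),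
      add_assoc]
    push_cast
    rw [sub_add_cancel]

theorem defectVanishes : DefectVanishes g := by
  rw [← defectVanishes_add_int_iff hg (1 - ⌈g.re⌉)]
  have hre : (g + (1 - ⌈g.re⌉ : ℤ)).re = g.re + 1 - ⌈g.re⌉ := by
    rw [add_re, intCast_re]
    push_cast
    ring
  have hg' := (add_intCast_mem_integerComplement (1 - ⌈g.re⌉)).2 hg
  exact .of_re_lt hg' fun c hc p hcg hp => defect_eq_zero_of_strip hc hg' hcg
    (by linarith [Int.ceil_lt_add_one g.re]) (by linarith [Int.le_ceil g.re]) hp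

end Continuation

theorem pochSum_eq_closedForm {c p g : ℂ} (hc : c ∈ integerComplement)
    (hg : g ∈ integerComplement) (hcp : c.re < p.re) (h : IntOrReGT p (g.re - 1)) :
    pochSum c p g = closedForm c p g :=
  sub_eq_zero.1 (defectVanishes hg c hc p hcp h)

/-! ### Summation by parts against the digamma function -/

lemma digamma_add_nat {x : ℂ} (hx : ∀ n : ℕ, x ≠ -n) (n : ℕ) :
    digamma (x + n) = digamma x + ∑ j ∈ Finset.range n, (x + j)⁻¹ := by
  induction n with
  | zero => simp
  | succ n ih =>
    rw [Finset.sum_range_succ, ← add_assoc, ← ih,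
      ← digamma_apply_add_one _ (add_nat_ne_neg_nat hx n), Nat.cast_succ, add_assoc]

lemma isBigO_sum_range_rpow {f : ℕ → ℂ} {ε : ℝ} (hε : 0 < ε)
    (hf : f =O[atTop] fun n : ℕ => (n : ℝ) ^ (-1 : ℝ)) :
    (fun n : ℕ => ∑ j ∈ Finset.range n, f j) =O[atTop] fun n : ℕ => (n : ℝ) ^ ε := by
  have hpow : (fun j : ℕ => ((j : ℝ) + 1) ^ (-ε)) =O[atTop] fun j : ℕ => (j : ℝ) ^ (-ε) := by
    refine IsBigO.of_bound 1 ?_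
    filter_upwards [eventually_gt_atTop 0] with j hj
    have hj' : (0 : ℝ) < j := Nat.cast_pos.2 hj
    rw [one_mul, Real.norm_of_nonneg (by positivity), Real.norm_of_nonneg (by positivity)]
    exact Real.rpow_le_rpow_of_nonpos hj' (by linarith) (by linarith)
  have hs : Summable fun j : ℕ => ‖f j‖ * ((j : ℝ) + 1) ^ (-ε) := by
    refine summable_of_isBigO_nat (Real.summable_nat_rpow.2 (by linarith : -1 - ε < -1))
      ((hf.norm_left.mul hpow).congr' EventuallyEq.rfl ?_)
    filter_upwards [eventually_gt_atTop 0] with j hj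
    rw [sub_eq_add_neg, Real.rpow_add (Nat.cast_pos.2 hj)]
  refine IsBigO.of_bound (∑' j, ‖f j‖ * ((j : ℝ) + 1) ^ (-ε)) (Eventually.of_forall fun n => ?_)
  rw [Real.norm_of_nonneg (by positivity)]
  have hterm (j : ℕ) (hj : j ∈ Finset.range n) :
      ‖f j‖ ≤ ‖f j‖ * ((j : ℝ) + 1) ^ (-ε) * (n : ℝ) ^ ε := by
    have hjn : (j : ℝ) + 1 ≤ n := by exact_mod_cast Finset.mem_range.1 hj
    have hj0 : (0 : ℝ) < (j : ℝ) + 1 := j.cast_add_one_pos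
    rw [mul_assoc, Real.rpow_neg hj0.le, inv_mul_eq_div]
    exact le_mul_of_one_le_right (norm_nonneg _)
      ((one_le_div (by positivity)).2 (Real.rpow_le_rpow hj0.le hjn hε.le))
  calc ‖∑ j ∈ Finset.range n, f j‖
      ≤ ∑ j ∈ Finset.range n, ‖f j‖ * ((j : ℝ) + 1) ^ (-ε) * (n : ℝ) ^ ε :=
        (norm_sum_le _ _).trans (Finset.sum_le_sum hterm)
    _ ≤ (∑' j, ‖f j‖ * ((j : ℝ) + 1) ^ (-ε)) * (n : ℝ) ^ ε := by
        rw [← Finset.sum_mul]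
        gcongr
        exact hs.sum_le_tsum _ fun j _ => by positivity

lemma isBigO_digamma {x : ℂ} {ε : ℝ} (hx : ∀ n : ℕ, x ≠ -n) (hε : 0 < ε) :
    (fun n : ℕ => digamma (x + n)) =O[atTop] fun n : ℕ => (n : ℝ) ^ ε := by
  have hconst : (fun _ : ℕ => digamma x) =O[atTop] fun n : ℕ => (n : ℝ) ^ ε := by
    refine (isLittleO_const_left.2 (Or.inr ?_)).isBigO
    exact tendsto_norm_atTop_atTop.comp ((tendsto_rpow_atTop hε).comp tendsto_natCast_atTop_atTop)
  exact (hconst.add (isBigO_sum_range_rpow hε (isBigO_inv_add x))).congr_left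
    fun n => (digamma_add_nat hx n).symm

section Digamma

variable {c p g : ℂ}

lemma summable_poch_mul_rGamma_mul_digamma (hx : ∀ n : ℕ, g ≠ -n) (hcp : c.re < p.re) :
    Summable fun l : ℕ => poch c l * rGamma (p + 1 + l) * digamma (g + l) :=
  summable_of_isBigO_rpow (a := (c.re - p.re) / 2 - 1) (isBigO_mul_rpow
    (isBigO_poch_mul_rGamma c (p + 1)) (isBigO_digamma hx (ε := (p.re - c.re) / 2) (by linarith))
    (by rw [add_re, one_re]; ring)) (by linarith)

lemma tendsto_poch_mul_rGamma_mul_digamma_zero (hx : ∀ n : ℕ, g ≠ -n) (hcp : c.re < p.re) :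
    Tendsto (fun l : ℕ => poch c l * rGamma (p + l) * digamma (g + l)) atTop (𝓝 0) :=
  tendsto_zero_of_isBigO_rpow (a := (c.re - p.re) / 2) (isBigO_mul_rpow
    (isBigO_poch_mul_rGamma c p) (isBigO_digamma hx (ε := (p.re - c.re) / 2) (by linarith))
    (by ring)) (by linarith)

lemma tsum_poch_mul_rGamma_mul_digamma (hg : g ∈ integerComplement) (hcp : c.re < p.re) :
    (p - c) * ∑' l : ℕ, poch c l * rGamma (p + 1 + l) * digamma (g + 1 + l)
      = digamma g * rGamma p + pochSum c p g := by
  have hg0 := ne_neg_nat_of_mem_integerComplement hg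
  have hg1 := ne_neg_nat_of_mem_integerComplement (add_one_mem_integerComplement.2 hg)
  have hs := (summable_poch_mul_rGamma_mul_digamma hg1 hcp).mul_left (p - c)
  have hS := summable_pochSum (g := g) hcp
  have hstep (l : ℕ) : (p - c) * (poch c l * rGamma (p + 1 + l) * digamma (g + 1 + l))
      - poch c l * rGamma (p + l) * (g + l)⁻¹
      = -(poch c (l + 1) * rGamma (p + (l + 1 : ℕ)) * digamma (g + (l + 1 : ℕ)))
        - -(poch c l * rGamma (p + l) * digamma (g + l)) := by
    rw [Nat.cast_succ, ← add_assoc g, add_right_comm g 1,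
      digamma_apply_add_one _ (add_nat_ne_neg_nat hg0 l)]
    have := poch_mul_rGamma_sub c p l
    rw [Nat.cast_succ] at this
    linear_combination -(digamma (g + l) + (g + l)⁻¹) * this
  have ht := tsum_eq_of_telescope (hs.sub hS) hstep
    (tendsto_poch_mul_rGamma_mul_digamma_zero hg0 hcp).neg
  rw [Summable.tsum_sub hs hS, tsum_mul_left, ← pochSum, poch_zero, Nat.cast_zero, add_zero,
    add_zero] at ht
  linear_combination ht

theorem hasSum_Gamma_div_Gamma_mul_digamma (hc : c ∈ integerComplement)
    (hg : g ∈ integerComplement) (hcp : c.re < p.re) (h : IntOrReGT p (g.re - 1)) :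
    HasSum (fun l : ℕ => Gamma (c + l) / Gamma (p + 1 + l) * digamma (g + 1 + l))
      (Gamma c / (p - c) * (digamma g * rGamma p + closedForm c p g)) := by
  have hg1 := ne_neg_nat_of_mem_integerComplement (add_one_mem_integerComplement.2 hg)
  have hs := (summable_poch_mul_rGamma_mul_digamma hg1 hcp).hasSum.mul_left (Gamma c)
  rw [← pochSum_eq_closedForm hc hg hcp h, ← tsum_poch_mul_rGamma_mul_digamma hg hcp,
    ← mul_assoc, div_mul_cancel₀ _ (sub_ne_zero_of_re_lt hcp)]
  refine hs.congr_fun fun l => ?_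
  rw [Gamma_add_nat (ne_neg_nat_of_mem_integerComplement hc), rGamma]
  ring

end Digamma

/-! ### The series in the parameters `c`, `m`, `f` -/

section AuxTerm

variable {c m f : ℂ}

lemma auxTermRatio_eq (c m f : ℂ) (l : ℕ) :
    auxTermRatio c m f l = newtonCoeff c (f - 1) l * binomCoeff (m - 1) l := by
  rw [auxTermRatio, newtonCoeff, binomCoeff, poch, rGamma, rGamma, rGamma, sub_add_cancel,
    div_eq_mul_inv, mul_inv, mul_inv, mul_inv]
  ring

lemma auxTerm_eq_Gamma_mul_auxTermRatio (hfc : ∀ n : ℕ, f - c ≠ -n) (m : ℂ) (l : ℕ) :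
    auxTerm c m f l = Gamma (f - c) * auxTermRatio c m f l := by
  rw [auxTerm, auxTermRatio, Gamma_add_nat hfc, poch]
  ring

lemma auxTerm_intCast_eq_zero (c f : ℂ) {n : ℤ} {l : ℕ} (hl : n - 1 ≤ l) :
    auxTerm c n f l = 0 := by
  have hΓ := binomCoeff_intCast_eq_zero hl
  rw [binomCoeff, rGamma, rGamma, Int.cast_sub, Int.cast_one] at hΓ
  rw [auxTerm, div_eq_mul_inv, mul_inv, mul_inv, mul_inv]
  linear_combination (Gamma (f - c + l) * (Gamma (2 - c + l))⁻¹ * (1 - c + l)⁻¹) * hΓ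

lemma tsum_auxTermRatio_eq_sum {k : ℕ} (hk : c = f + k) (m : ℂ) :
    ∑' l, auxTermRatio c m f l = ∑ l ∈ Finset.range (k + 1), auxTermRatio c m f l := by
  refine tsum_eq_sum fun l hl => ?_
  rw [Finset.mem_range, not_lt] at hl
  rw [auxTermRatio, (ascPochhammer_eval_eq_zero_iff l (f - c)).2 ⟨k, hl, by rw [hk]; ring⟩,
    zero_mul, zero_div]

section Admissible

variable (hmf : (∃ n : ℤ, m = n) ∨ -1 < (m - f).re)

include hmf

lemma intOrReGT_sub_one : IntOrReGT (m - 1) ((f - 1).re - 1) := by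
  refine hmf.imp (fun ⟨n, hn⟩ => ⟨n - 1, by rw [hn]; push_cast; rfl⟩) fun h => ?_
  simp only [sub_re, one_re] at h ⊢
  linarith

lemma summable_auxTermRatio (c : ℂ) : Summable fun l : ℕ => auxTermRatio c m f l := by
  simp_rw [auxTermRatio_eq]
  exact summable_auxSum (intOrReGT_sub_one hmf)

theorem hasSum_Gamma_div_Gamma_mul_digamma_auxTermRatio (hc : c ∈ integerComplement)
    (hf : f ∈ integerComplement) (hmc : 1 < (m - c).re) :
    HasSum (fun l : ℕ => Gamma (c + l) / Gamma (m + l) * digamma (f + l))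
      (Gamma c / (m - c - 1) * ((digamma (f - 1) + 1 / (m - c - 1)) / Gamma (m - 1)
        - Gamma f * Gamma (1 - f) * Gamma (1 - c) / (Gamma (f - c) * Gamma (m - f))
        - Gamma (2 - f) * Gamma (m - c) / Gamma (m - f) * ∑' l : ℕ, auxTermRatio c m f l)) := by
  have hg : f - 1 ∈ integerComplement := by rwa [← add_one_mem_integerComplement, sub_add_cancel]
  have hcp : c.re < (m - 1).re := by
    simp only [sub_re, one_re] at hmc ⊢
    linarith
  have h := hasSum_Gamma_div_Gamma_mul_digamma hc hg hcp (intOrReGT_sub_one hmf)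
  rw [closedForm, gammaPart, auxPart, auxSum] at h
  simp_rw [← auxTermRatio_eq] at h
  rw [sub_add_cancel, sub_add_cancel, add_sub_cancel, neg_sub, sub_sub_sub_cancel_right,
    show 1 - (f - 1) = 2 - f by ring, sub_right_comm m 1 c] at h
  convert h using 1
  simp only [rGamma, div_eq_mul_inv, mul_inv, one_mul]
  ring

end Admissible

end AuxTerm

end GammaSum

open GammaSum in
theorem theorem4p5 (c m f : ℂ)
    (hc : ∀ n : ℤ, c ≠ n) (hf : ∀ n : ℤ, f ≠ n)
    (hmc : 1 < (m - c).re)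
    (hmf : (∃ n : ℤ, m = n) ∨ -1 < (m - f).re) :
    ((∀ k : ℕ, c ≠ f + k) →
      (∀ n : ℤ, m = n → ∀ l : ℕ, n - 1 ≤ (l : ℤ) → auxTerm c m f l = 0) ∧
      Summable (fun l : ℕ => auxTerm c m f l) ∧
      HasSum
        (fun l : ℕ => Complex.Gamma (c + l) / Complex.Gamma (m + l) * Complex.digamma (f + l))
        (Complex.Gamma c / (m - c - 1) *
          ((Complex.digamma (f - 1) + 1 / (m - c - 1)) / Complex.Gamma (m - 1)
            - Complex.Gamma f * Complex.Gamma (1 - f) * Complex.Gamma (1 - c)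
                / (Complex.Gamma (f - c) * Complex.Gamma (m - f))
            - Complex.Gamma (2 - f) * Complex.Gamma (m - c)
                / (Complex.Gamma (m - f) * Complex.Gamma (f - c))
              * ∑' l : ℕ, auxTerm c m f l))) ∧
    (∀ k : ℕ, c = f + k →
      HasSum
        (fun l : ℕ => Complex.Gamma (c + l) / Complex.Gamma (m + l) * Complex.digamma (f + l))
        (Complex.Gamma c / (m - c - 1) *
          ((Complex.digamma (f - 1) + 1 / (m - c - 1)) / Complex.Gamma (m - 1)
            - Complex.Gamma (2 - f) * Complex.Gamma (m - c) / Complex.Gamma (m - f)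
              * ∑ l ∈ Finset.range (k + 1), auxTermRatio c m f l))) := by
  have hmain := hasSum_Gamma_div_Gamma_mul_digamma_auxTermRatio hmf
    (fun ⟨n, hn⟩ => hc n hn.symm) (fun ⟨n, hn⟩ => hf n hn.symm) hmc
  refine ⟨fun hcf => ?_, fun k hk => ?_⟩
  · have hfc (n : ℕ) : f - c ≠ -n := fun hn => hcf n (by linear_combination -hn)
    have haux := auxTerm_eq_Gamma_mul_auxTermRatio hfc m
    refine ⟨?_, ?_, ?_⟩
    · rintro n rfl l hl
      exact auxTerm_intCast_eq_zero c f hl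
    · simpa only [haux] using (summable_auxTermRatio hmf c).mul_left (Gamma (f - c))
    · simp_rw [haux, tsum_mul_left]
      convert hmain using 3
      field_simp [Gamma_ne_zero hfc]
  · have hpole : (Gamma (f - c))⁻¹ = 0 := by
      rw [hk, sub_add_cancel_left]
      exact rGamma_neg_nat k
    rw [← tsum_auxTermRatio_eq_sum hk]
    simpa only [div_eq_mul_inv, mul_inv, hpole, zero_mul, mul_zero, sub_zero] using hmain
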